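/- For a number field $K$ of degree $d>1$ let $D_K$ be the absolute value of its discriminant, and let $H_K(\alpha)=\prod_{v}\max\{1,|\alpha|_v\}^{d_v}$ be the relative multiplicative Weil height of $\alpha\in K$, where $v$ runs over the places of $K$, $|\cdot|_v$ extends the usual archimedean or a $p$-adic absolute value of $\mathbb{Q}$, and $d_v=[K_v:\mathbb{Q}_v]$. For real $X>0$ let $$N'_K(X)=\#\{\gamma\in K : K=\mathbb{Q}(\gamma),\ H_K(\gamma)<X\},$$ and for a positive integer $\ell$ put $$M_{K,\ell}=\inf_{X>0}\, X^{-1/\ell}\bigl(1+N'_K(X)\bigr),\qquad f(\ell,d)=\liminf_{[K:\mathbb{Q}]=d}\frac{-\log M_{K,\ell}}{\log D_K},$$ where the lower limit is taken over the number fields $K$ of degree $d$ (inside a fixed algebraic closure of $\mathbb{Q}$) as $D_K\to\infty$. Proposition. Let $d>1$ and $\ell\ge d/2$ be integers. Then $$f(\ell,d)=\frac{1}{2\ell(d-1)}.$$ -/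

import Mathlib

open Filter
open scoped IntermediateField

noncomputable section

/-- The primitive elements `γ` of `K` (that is, `K = ℚ(γ)`) whose relative multiplicative Weil
height `H_K(γ) = ∏_v max(1, |γ|_v) ^ d_v` is less than `X`. In `Height.mulHeight₁` the complex
places count twice and the absolute value at a prime `𝔭` satisfies `|𝔭| = 1 / N(𝔭)`, so the local
degrees `d_v` are built in. -/
def smallGenerators (K : Type*) [Field K] [NumberField K] (X : ℝ) : Set K :=
  {γ : K | ℚ⟮γ⟯ = ⊤ ∧ Height.mulHeight₁ γ < X}

/-- There are only finitely many generators of bounded height, so that counting them by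
`Set.ncard` makes sense. -/
theorem smallGenerators_finite (K : Type*) [Field K] [NumberField K] (X : ℝ) :
    (smallGenerators K X).Finite :=
  (Northcott.finite_le (h := Height.mulHeight₁ (K := K)) X).subset fun _ h => h.2.le

/-- `N'_K(X)`: the number of primitive elements of `K` of relative height less than `X`. -/
def numSmallGenerators (K : Type*) [Field K] [NumberField K] (X : ℝ) : ℕ :=
  (smallGenerators K X).ncard

/-- `M_{K,ℓ} = inf_{X > 0} X ^ (-1/ℓ) * (1 + N'_K(X))`, an infimum of positive real numbers. -/
def ellenbergM (K : Type*) [Field K] [NumberField K] (ℓ : ℕ) : ℝ :=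
  ⨅ X : {X : ℝ // 0 < X}, (X : ℝ) ^ (-(1 / (ℓ : ℝ))) * (1 + (numSmallGenerators K X : ℝ))

/-- The number fields of degree `d`, realised inside a fixed algebraic closure of `ℚ`. -/
def DegreeField (d : ℕ) : Type :=
  {K : IntermediateField ℚ (AlgebraicClosure ℚ) //
    FiniteDimensional ℚ K ∧ Module.finrank ℚ K = d}

instance DegreeField.numberField {d : ℕ} (K : DegreeField d) : NumberField K.1 :=
  haveI := K.2.1
  { }

/-- `D_K`: the absolute value of the discriminant. -/
def absDiscr (K : Type*) [Field K] [NumberField K] : ℕ :=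
  (NumberField.discr K).natAbs

/-- Ellenberg's exponent `f(ℓ, d) = liminf (-log M_{K,ℓ} / log D_K)`, where `K` runs through the
number fields of degree `d` and `D_K → ∞`. The lower limit is taken in the extended reals, with
`log 0 = -∞`. -/
def ellenbergExponent (ℓ d : ℕ) : EReal :=
  liminf (fun K : DegreeField d =>
      -ENNReal.log (ENNReal.ofReal (ellenbergM K.1 ℓ)) /
        ((Real.log (absDiscr K.1) : ℝ) : EReal))
    (comap (fun K : DegreeField d => absDiscr K.1) atTop)

end

open NumberField Module

/-! Write `s = 1/(2ℓ(d-1))`. Any generator `γ` of `K` satisfies `D_K ≤ (d!)² H(γ)^(2(d-1))`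
(`discr_le_mulHeight₁_pow`), so `N'_K` vanishes up to `X ≍ D_K^(1/(2(d-1)))`. Taking that `X` in the
infimum gives `M ≪ D_K^(-s)`, hence `f ≥ s`.

Conversely, one generator of height `H` yields the `T²` generators `mγ + n`, `1 ≤ m, n ≤ T`, of
height at most `(2T)^d H`. Hence `1 + N'_K(X) ≫ (X/H)^(2/d) ≥ (X/H)^(1/ℓ)` for `X ≥ H`, because `ℓ ≥
d/2`, and so `M ≫ H^(-1/ℓ)` (`le_ellenbergM`). For `γ^d = p/q` with primes `p < q ≤ 2p`, total
ramification at `p` and `q` gives `D_K ≥ (pq)^(d-1)`, while `H(γ) ≤ q`. The first bound is thus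
sharp up to a constant on infinitely many fields, and `f ≤ s`. -/

theorem norm_det_le_factorial_mul_prod {n 𝕜 : Type*} [Fintype n] [DecidableEq n] [NormedField 𝕜]
    (A : Matrix n n 𝕜) (B : n → ℝ) (h : ∀ i j, ‖A i j‖ ≤ B j) :
    ‖A.det‖ ≤ (Fintype.card n).factorial * ∏ j, B j := by
  rw [Matrix.det_apply]
  refine (norm_sum_le _ _).trans ?_
  calc _ ≤ ∑ _σ : Equiv.Perm n, ∏ j, B j := by
        refine Finset.sum_le_sum fun σ _ => ?_
        rw [Units.smul_def, ← Int.cast_smul_eq_zsmul 𝕜, smul_eq_mul, norm_mul]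
        have : ‖(((Equiv.Perm.sign σ : ℤˣ) : ℤ) : 𝕜)‖ = 1 := by
          rcases Int.units_eq_one_or (Equiv.Perm.sign σ) with h | h <;> simp [h]
        rw [this, one_mul, norm_prod]
        exact Finset.prod_le_prod (fun _ _ => norm_nonneg _) fun j _ => h _ _
    _ = _ := by simp [Fintype.card_perm]

/-- The coordinate matrix of `x` factors through a basis of `I`, whose own determinant is `± N(I)`.
-/
theorem absNorm_dvd_basis_det {S ι : Type*} [CommRing S] [IsDedekindDomain S] [Module.Free ℤ S]
    [Module.Finite ℤ S] [Fintype ι] [DecidableEq ι] (b : Basis ι ℤ S) {I : Ideal S} (hI : I ≠ ⊥)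
    {x : ι → S} (hx : ∀ i, x i ∈ I) : (Ideal.absNorm I : ℤ) ∣ b.det x := by
  let bI := I.selfBasis b hI
  have h1 : b.toMatrix x = b.toMatrix (Subtype.val ∘ bI) * bI.toMatrix (fun i => ⟨x i, hx i⟩) := by
    ext i j
    have h2 : x j = ∑ k, bI.repr ⟨x j, hx j⟩ k • (bI k : S) := by
      refine (congrArg Subtype.val (bI.sum_repr ⟨x j, hx j⟩)).symm.trans ?_
      rw [Submodule.coe_sum]
      rfl
    rw [Matrix.mul_apply, Basis.toMatrix_apply]
    conv_lhs => rw [h2, map_sum, Finsupp.finsetSum_apply]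
    refine Finset.sum_congr rfl fun k _ => ?_
    rw [map_zsmul, Finsupp.smul_apply, smul_eq_mul, mul_comm]
    rfl
  rw [Basis.det_apply, h1, Matrix.det_mul, ← Basis.det_apply]
  refine Dvd.dvd.mul_right ?_ _
  rw [← Ideal.natAbs_det_basis_change b I bI, Int.natAbs_dvd]

/-! ### Lower bound for the height of a generator -/

section

variable {K : Type*} [Field K] [NumberField K]

theorem discr_coe_eq_det_sq_mul {ι : Type*} [Fintype ι] [DecidableEq ι] (b : Basis ι ℤ (𝓞 K))
    (x : ι → 𝓞 K) :
    Algebra.discr ℚ (fun i => (x i : K)) = ((b.det x : ℤ) : ℚ) ^ 2 * (discr K : ℚ) := by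
  let bQ : Basis ι ℚ K := b.localizationLocalization ℚ (nonZeroDivisors ℤ) K
  have h1 : Algebra.discr ℚ bQ = (discr K : ℚ) := by
    rw [← discr_eq_discr K b]
    exact Algebra.discr_localizationLocalization ℤ (nonZeroDivisors ℤ) K b
  have h2 : (fun i => (x i : K)) = Matrix.vecMul bQ
      (((b.toMatrix x).map (Int.cast : ℤ → ℚ)).map (algebraMap ℚ K)) := by
    ext i
    have h3 := congrArg (algebraMap (𝓞 K) K) (b.sum_repr (x i))
    refine h3.symm.trans ?_
    simp [Matrix.vecMul, dotProduct, Basis.toMatrix_apply, bQ,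
      Basis.localizationLocalization_apply, mul_comm, zsmul_eq_mul]
  rw [h2, Algebra.discr_of_matrix_vecMul, h1, Basis.det_apply]
  congr 2
  exact (RingHom.map_det (Int.castRingHom ℚ) _).symm

theorem prod_embeddings_eq_prod_infinitePlace (f : InfinitePlace K → ℝ) :
    ∏ φ : K →ₐ[ℚ] ℂ, f (InfinitePlace.mk (φ : K →+* ℂ)) = ∏ v : InfinitePlace K, f v ^ v.mult := by
  classical
  rw [← Fintype.prod_equiv (RingHom.equivRatAlgHom K ℂ) (fun φ => f (InfinitePlace.mk φ))
    (fun φ => f (InfinitePlace.mk (φ : K →+* ℂ))) fun _ => by rfl]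
  rw [← Finset.prod_fiberwise Finset.univ InfinitePlace.mk]
  refine Finset.prod_congr rfl fun w _ => ?_
  rw [Finset.prod_congr rfl (g := fun _ => f w) fun φ hφ => by rw [(Finset.mem_filter.mp hφ).2],
    Finset.prod_const, InfinitePlace.card_filter_mk_eq]

/-- The finite places contribute exactly `N(a, b)⁻¹` to the height of the point `(a : b)`. -/
theorem mulHeight₁_div_mul_absNorm (a b : 𝓞 K) (hb : b ≠ 0) :
    Height.mulHeight₁ ((a : K) / b) * (Ideal.span (Set.range ![a, b])).absNorm =
      ∏ v : InfinitePlace K, max (v a) (v b) ^ v.mult := by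
  have hne : ![(a : K), (b : K)] ≠ 0 := fun h => hb (by simpa using congrFun h 1)
  have hne' : ![a, b] ≠ 0 := fun h => hb (by simpa using congrFun h 1)
  rw [Height.mulHeight₁_div_eq_mulHeight, mulHeight_eq hne]
  have h1 := absNorm_mul_finprod_finitePlace_eq_one hne'
  have h2 : ∀ i, (((![a, b] i : 𝓞 K)) : K) = ![(a : K), (b : K)] i := by
    intro i; fin_cases i <;> rfl
  simp only [h2] at h1
  rw [mul_assoc, mul_comm (finprod _), h1, mul_one]
  refine Finset.prod_congr rfl fun v _ => ?_
  rw [← eq_of_forall_ge_iff (a := max (v a) (v b)) (b := ⨆ i, v (![(a : K), (b : K)] i))]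
  intro c
  simp [ciSup_le_iff, Fin.forall_fin_two]

/-- With `γ = a/b` and `J = (a, b)`, compute the discriminant of the `a^i b^(d-1-i)` twice. It is
`D_K` times the square of an index divisible by `N(J)^(d-1)`, and it is the square of a determinant
of size at most `d! (H(γ) N(J))^(d-1)`. The powers of `N(J)` cancel. -/
theorem discr_le_mulHeight₁_pow {γ : K} (hγ : ℚ⟮γ⟯ = ⊤) :
    ((discr K).natAbs : ℝ) ≤ ((finrank ℚ K).factorial : ℝ) ^ 2 *
      Height.mulHeight₁ γ ^ (2 * (finrank ℚ K - 1)) := by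
  classical
  obtain ⟨a, b, hb0, hab⟩ := IsFractionRing.div_surjective (A := 𝓞 K) γ
  have hb : b ≠ 0 := nonZeroDivisors.ne_zero hb0
  have hbK : (b : K) ≠ 0 := by simpa using hb
  set d := finrank ℚ K with hd
  set J := Ideal.span (Set.range ![a, b]) with hJ
  have haJ : a ∈ J := Ideal.subset_span ⟨0, rfl⟩
  have hbJ : b ∈ J := Ideal.subset_span ⟨1, rfl⟩
  have hJ0 : J ≠ ⊥ := fun h => hb (by simpa [h] using hbJ)
  let x : Fin d → 𝓞 K := fun i => a ^ (i : ℕ) * b ^ (d - 1 - i)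
  have hxJ : ∀ i, x i ∈ J ^ (d - 1) := fun i => by
    have := Ideal.mul_mem_mul (Ideal.pow_mem_pow haJ i) (Ideal.pow_mem_pow hbJ (d - 1 - i))
    rwa [← pow_add, Nat.add_sub_cancel' (by lia)] at this
  have hxγ : ∀ i, (x i : K) = (b : K) ^ (d - 1) * γ ^ (i : ℕ) := fun i => by
    have h1 : (b : K) ^ (d - 1) = b ^ (i : ℕ) * b ^ (d - 1 - i) := by
      rw [← pow_add, Nat.add_sub_cancel' (by lia)]
    rw [← hab, h1]
    simp only [x, map_mul, map_pow, div_pow]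
    field_simp
  have hli : LinearIndependent ℚ (fun i : Fin d => (x i : K)) := by
    have h1 := linearIndependent_pow (K := ℚ) γ
    rw [(Field.primitive_element_iff_minpoly_natDegree_eq ℚ γ).mp hγ] at h1
    have h2 := h1.map' (LinearMap.mulLeft ℚ ((b : K) ^ (d - 1)))
      (LinearMap.ker_eq_bot.mpr (mul_right_injective₀ (pow_ne_zero _ hbK)))
    have h3 : (fun i : Fin d => (x i : K)) =
        LinearMap.mulLeft ℚ ((b : K) ^ (d - 1)) ∘ fun i : Fin d => γ ^ (i : ℕ) :=
      funext fun i => by simp [hxγ]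
    rw [h3]
    exact h2
  have hcard : Fintype.card (Fin d) = finrank ℚ K := by simp [hd]
  have : Nonempty (Fin d) := ⟨⟨0, finrank_pos⟩⟩
  have hdisc : Algebra.discr ℚ (fun i : Fin d => (x i : K)) ≠ 0 := by
    have := Algebra.discr_not_zero_of_basis ℚ (basisOfLinearIndependentOfCardEqFinrank hli hcard)
    simpa using this
  let B : Basis (Fin d) ℤ (𝓞 K) := (RingOfIntegers.basis K).reindex
    (Fintype.equivOfCardEq (by
      rw [← finrank_eq_card_basis (RingOfIntegers.basis K), RingOfIntegers.rank, hcard]))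
  have hformula := discr_coe_eq_det_sq_mul B x
  have hdvd := absNorm_dvd_basis_det B (pow_ne_zero _ hJ0) hxJ
  have hdet0 : B.det x ≠ 0 := by
    rintro h; rw [h] at hformula; simp [hdisc] at hformula
  have hN : ((J.absNorm : ℝ)) ^ (d - 1) ≤ |((B.det x : ℤ) : ℝ)| := by
    rw [map_pow] at hdvd
    have := Int.le_of_dvd (abs_pos.mpr hdet0) ((dvd_abs _ _).mpr hdvd)
    exact_mod_cast this
  let e : Fin d ≃ (K →ₐ[ℚ] ℂ) := Fintype.equivOfCardEq (by rw [hcard, AlgHom.card])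
  have hE := Algebra.discr_eq_det_embeddingsMatrixReindex_pow_two ℚ ℂ (fun i => (x i : K)) e
  let m : (InfinitePlace K) → ℝ := fun v => max (v a) (v b)
  have hm : ∀ v, 0 ≤ m v := fun v => le_max_of_le_left (apply_nonneg _ _)
  have hbound : ‖(Algebra.embeddingsMatrixReindex ℚ ℂ (fun i => (x i : K)) e).det‖ ≤
      d.factorial * (∏ v : InfinitePlace K, m v ^ v.mult) ^ (d - 1) := by
    have h1 := norm_det_le_factorial_mul_prod
      (Algebra.embeddingsMatrixReindex ℚ ℂ (fun i => (x i : K)) e)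
      (fun j => m (InfinitePlace.mk (e j : K →+* ℂ)) ^ (d - 1)) fun i j => by
        have h2 : Algebra.embeddingsMatrixReindex ℚ ℂ (fun i => (x i : K)) e i j =
          (e j) (x i : K) := rfl
        rw [h2]
        simp only [x, map_mul, map_pow, norm_mul, norm_pow]
        have h3 : ‖e j (a : K)‖ ≤ m (InfinitePlace.mk (e j : K →+* ℂ)) := le_max_left _ _
        have h4 : ‖e j (b : K)‖ ≤ m (InfinitePlace.mk (e j : K →+* ℂ)) := le_max_right _ _
        rw [← Nat.add_sub_cancel' (show (i : ℕ) ≤ d - 1 by lia), pow_add,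
          Nat.add_sub_cancel_left]
        gcongr
    rw [Fintype.card_fin, Finset.prod_pow,
      e.prod_comp (fun φ => m (InfinitePlace.mk (φ : K →+* ℂ))),
      prod_embeddings_eq_prod_infinitePlace] at h1
    exact h1
  rw [← mulHeight₁_div_mul_absNorm a b hb, hab] at hbound
  have hkey : |((B.det x : ℤ) : ℝ)| ^ 2 * ((discr K).natAbs : ℝ) =
      ‖(Algebra.embeddingsMatrixReindex ℚ ℂ (fun i => (x i : K)) e).det‖ ^ 2 := by
    rw [← norm_pow, ← hE, hformula]
    simp [Nat.cast_natAbs]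
  have hJpos : (0 : ℝ) < J.absNorm := by
    exact_mod_cast Nat.pos_of_ne_zero (Ideal.absNorm_eq_zero_iff.not.mpr hJ0)
  refine le_of_mul_le_mul_left ?_ (pow_pos (pow_pos hJpos (d - 1)) 2)
  calc _ ≤ |((B.det x : ℤ) : ℝ)| ^ 2 * ((discr K).natAbs : ℝ) := by gcongr
    _ ≤ (d.factorial * (Height.mulHeight₁ γ * J.absNorm) ^ (d - 1)) ^ 2 := by
        rw [hkey]; gcongr
    _ = _ := by rw [mul_pow, mul_pow]; ring

end

/-! ### Heights of affine images of a generator -/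

section

variable {K : Type*} [Field K] [NumberField K]

theorem adjoin_eq_top_of_mem {x y : K} (hx : ℚ⟮x⟯ = ⊤) (h : x ∈ ℚ⟮y⟯) : ℚ⟮y⟯ = ⊤ :=
  top_le_iff.mp (hx ▸ IntermediateField.adjoin_simple_le_iff.mpr h)

/-- Since `(ma + nb, b) ⊆ (a, b)`, the finite part of the height does not grow; each archimedean
factor grows by at most `2T` per local degree. -/
theorem mulHeight₁_natCast_mul_add_natCast_le (γ : K) {m n T : ℕ} (hT : 1 ≤ T) (hm : m ≤ T) (hn : n ≤ T) :
    Height.mulHeight₁ ((m : K) * γ + n) ≤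
      (2 * (T : ℝ)) ^ finrank ℚ K * Height.mulHeight₁ γ := by
  obtain ⟨a, b, hb0, hab⟩ := IsFractionRing.div_surjective (A := 𝓞 K) γ
  have hb : b ≠ 0 := nonZeroDivisors.ne_zero hb0
  have hbK : (b : K) ≠ 0 := by simpa using hb
  set J := Ideal.span (Set.range ![a, b]) with hJ
  set J' := Ideal.span (Set.range ![(m : 𝓞 K) * a + (n : 𝓞 K) * b, b]) with hJ'
  have haJ : a ∈ J := Ideal.subset_span ⟨0, rfl⟩
  have hbJ : b ∈ J := Ideal.subset_span ⟨1, rfl⟩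
  have hbJ' : b ∈ J' := Ideal.subset_span ⟨1, rfl⟩
  have hJ'0 : J' ≠ ⊥ := fun h => hb (by simpa [h] using hbJ')
  have hle : J' ≤ J := by
    rw [hJ', Ideal.span_le]
    rintro _ ⟨i, rfl⟩
    fin_cases i
    · exact J.add_mem (J.mul_mem_left _ haJ) (J.mul_mem_left _ hbJ)
    · exact hbJ
  have hpos : 0 < J'.absNorm := Nat.pos_of_ne_zero (Ideal.absNorm_eq_zero_iff.not.mpr hJ'0)
  have hN : (J.absNorm : ℝ) ≤ J'.absNorm := by
    exact_mod_cast Nat.le_of_dvd hpos (Ideal.absNorm_dvd_absNorm_of_le hle)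
  have hT' : (1 : ℝ) ≤ T := by exact_mod_cast hT
  have h1 := mulHeight₁_div_mul_absNorm a b hb
  have h2 := mulHeight₁_div_mul_absNorm ((m : 𝓞 K) * a + (n : 𝓞 K) * b) b hb
  have h3 : (((m : 𝓞 K) * a + (n : 𝓞 K) * b : 𝓞 K) : K) / b = (m : K) * γ + n := by
    rw [← hab]
    simp only [map_add, map_mul, map_natCast]
    field_simp
  rw [h3] at h2
  replace hab : (a : K) / b = γ := hab
  rw [hab] at h1
  refine le_of_mul_le_mul_right ?_ (Nat.cast_pos (α := ℝ).mpr hpos)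
  rw [h2]
  calc _ ≤ ∏ v : InfinitePlace K, (2 * T * max (v a) (v b)) ^ v.mult := by
        refine Finset.prod_le_prod (fun v _ => by positivity) fun v _ => ?_
        gcongr
        have ha0 : 0 ≤ v a := apply_nonneg _ _
        have hb0 : 0 ≤ v b := apply_nonneg _ _
        refine max_le ?_ ?_
        · simp only [map_add, map_mul, map_natCast]
          refine (v.1.add_le _ _).trans ?_
          have hmR : (m : ℝ) ≤ T := by exact_mod_cast hm
          have hnR : (n : ℝ) ≤ T := by exact_mod_cast hn
          have hvm : ∀ k : ℕ, v (k : K) = k := fun k => by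
            rw [← v.norm_embedding_eq]; simp
          change v ((m : K) * a) + v ((n : K) * b) ≤ _
          rw [map_mul, map_mul, hvm, hvm]
          calc (m : ℝ) * v a + n * v b ≤ T * max (v a) (v b) + T * max (v a) (v b) := by
                gcongr
                · exact le_max_left _ _
                · exact le_max_right _ _
            _ = _ := by ring
        · calc v b ≤ 1 * max (v a) (v b) := by rw [one_mul]; exact le_max_right _ _
            _ ≤ _ := by gcongr; linarith
    _ = (2 * T) ^ finrank ℚ K * (Height.mulHeight₁ γ * J.absNorm) := by
        rw [h1]
        simp_rw [mul_pow _ (max _ _)]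
        rw [Finset.prod_mul_distrib, Finset.prod_pow_eq_pow_sum, InfinitePlace.sum_mult_eq]
    _ ≤ _ := by
        rw [← mul_assoc]
        gcongr

/-! ### Fields generated by a `d`-th root of `p/q` -/

theorem mulHeight₁_le_of_pow_eq_div {γ : K} {p q : ℕ} (hq : q ≠ 0) (hpq : p ≤ q)
    (h : γ ^ finrank ℚ K = (p : K) / q) : Height.mulHeight₁ γ ≤ q := by
  have hd : finrank ℚ K ≠ 0 := finrank_pos.ne'
  refine le_of_pow_le_pow_left₀ hd (by positivity) ?_
  rw [← Height.mulHeight₁_pow, h]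
  have hqO : (q : 𝓞 K) ≠ 0 := by exact_mod_cast hq
  have h1 := mulHeight₁_div_mul_absNorm (p : 𝓞 K) (q : 𝓞 K) hqO
  have hvm : ∀ (v : InfinitePlace K) (k : ℕ), v (k : K) = k := fun v k => by
    rw [← v.norm_embedding_eq]; simp
  have hpqR : (p : ℝ) ≤ q := by exact_mod_cast hpq
  simp only [map_natCast, hvm, max_eq_right hpqR] at h1
  rw [Finset.prod_pow_eq_pow_sum, InfinitePlace.sum_mult_eq] at h1
  rw [← h1]
  refine le_mul_of_one_le_right (Height.mulHeight₁_nonneg _) ?_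
  have hJ0 : Ideal.span (Set.range ![(p : 𝓞 K), (q : 𝓞 K)]) ≠ ⊥ := fun h => hqO <| by
    have : (q : 𝓞 K) ∈ Ideal.span (Set.range ![(p : 𝓞 K), (q : 𝓞 K)]) :=
      Ideal.subset_span ⟨1, rfl⟩
    rwa [h, Ideal.mem_bot] at this
  exact_mod_cast Nat.pos_of_ne_zero (Ideal.absNorm_eq_zero_iff.not.mpr hJ0)

/-- A prime `P` above `p` contains `α` and is coprime to `a`, so `P^d ∣ p`. Then `P^(d-1)` divides
the different, and `N(P)` is a multiple of `p`. -/
theorem prime_pow_dvd_discr_of_pow_eq {p a : ℕ} (hp : p.Prime) (hpa : ¬ p ∣ a) {α : K}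
    (h : α ^ finrank ℚ K = (a : K) * p) : p ^ (finrank ℚ K - 1) ∣ (discr K).natAbs := by
  have hd : 0 < finrank ℚ K := finrank_pos
  have hint : IsIntegral ℤ α := by
    refine IsIntegral.of_pow hd ?_
    rw [h]
    exact_mod_cast isIntegral_algebraMap (R := ℤ) (A := K) (x := ((a * p : ℕ) : ℤ))
  obtain ⟨x, rfl⟩ : ∃ x : 𝓞 K, (x : K) = α := ⟨⟨α, hint⟩, rfl⟩
  have hx : x ^ finrank ℚ K = (a : 𝓞 K) * p := by
    apply RingOfIntegers.ext
    simpa using h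
  have hcop : IsCoprime (p : ℤ) (a : ℤ) :=
    Nat.isCoprime_iff_coprime.mpr ((Nat.Prime.coprime_iff_not_dvd hp).mpr hpa)
  have hne : Ideal.span {(p : 𝓞 K)} ≠ ⊤ := by
    intro htop
    have h1 := congrArg Ideal.absNorm htop
    rw [Ideal.absNorm_span_natCast, Ideal.absNorm_top, RingOfIntegers.rank] at h1
    exact hp.one_lt.ne' ((Nat.pow_eq_one.mp h1).resolve_right hd.ne')
  obtain ⟨P, hPmax, hP⟩ := Ideal.exists_le_maximal _ hne
  have hpP : (p : 𝓞 K) ∈ P := hP (Ideal.mem_span_singleton_self _)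
  have hone : ∀ k : ℕ, IsCoprime (p : ℤ) (k : ℤ) → (k : 𝓞 K) ∉ P := by
    rintro k ⟨u, v, huv⟩ hk
    refine hPmax.ne_top ((Ideal.eq_top_iff_one _).mpr ?_)
    have : (1 : 𝓞 K) = u * p + v * k := by exact_mod_cast (congrArg (Int.cast (R := 𝓞 K)) huv).symm
    rw [this]
    exact P.add_mem (P.mul_mem_left _ hpP) (P.mul_mem_left _ hk)
  have hxP : x ∈ P := by
    refine hPmax.isPrime.mem_of_pow_mem (finrank ℚ K) ?_
    rw [hx]
    exact P.mul_mem_left _ hpP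
  have hcopI : IsCoprime (P ^ finrank ℚ K) (Ideal.span {(a : 𝓞 K)}) := by
    refine IsCoprime.pow_left ?_
    rw [Ideal.isCoprime_iff_exists]
    obtain ⟨u, v, huv⟩ := hcop
    refine ⟨u * p, P.mul_mem_left _ hpP, v * a,
      Ideal.mul_mem_left _ _ (Ideal.mem_span_singleton_self _), ?_⟩
    exact_mod_cast congrArg (Int.cast (R := 𝓞 K)) huv
  have hdvd : P ^ finrank ℚ K ∣ Ideal.span {(p : 𝓞 K)} := by
    refine hcopI.dvd_of_dvd_mul_left ?_
    rw [Ideal.span_singleton_mul_span_singleton, ← hx, ← Ideal.span_singleton_pow]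
    exact pow_dvd_pow_of_dvd (Ideal.dvd_span_singleton.mpr hxP) _
  have hpZ : (Ideal.span {(p : ℤ)}).IsMaximal :=
    PrincipalIdealRing.isMaximal_of_irreducible (Nat.prime_iff_prime_int.mp hp).irreducible
  have hdiff := pow_sub_one_dvd_differentIdeal ℤ (p := Ideal.span {(p : ℤ)}) P (finrank ℚ K)
    (by simpa using hp.ne_zero) (by simpa [Ideal.map_span] using hdvd)
  have hnorm := Ideal.absNorm_dvd_absNorm_of_le (Ideal.le_of_dvd hdiff)
  rw [absNorm_differentIdeal K, map_pow] at hnorm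
  refine (pow_dvd_pow_of_dvd ?_ _).trans hnorm
  by_contra hnd
  exact hone _ (Nat.isCoprime_iff_coprime.mpr ((Nat.Prime.coprime_iff_not_dvd hp).mpr hnd))
    (Ideal.absNorm_mem P)

theorem mul_pow_le_absDiscr {γ : K} {p q : ℕ} (hp : p.Prime) (hq : q.Prime) (hpq : p ≠ q)
    (h : γ ^ finrank ℚ K = (p : K) / q) : (p * q) ^ (finrank ℚ K - 1) ≤ absDiscr K := by
  have hd : finrank ℚ K = finrank ℚ K - 1 + 1 := (Nat.sub_add_cancel finrank_pos).symm
  have hp0 : (p : K) ≠ 0 := by exact_mod_cast hp.ne_zero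
  have hq0 : (q : K) ≠ 0 := by exact_mod_cast hq.ne_zero
  have h1 : p ^ (finrank ℚ K - 1) ∣ (discr K).natAbs := by
    -- `(qγ)^d = q^(d-1) p` shows ramification at `p`; below, `(p/γ)^d = p^(d-1) q` does the same at
    -- `q`.
    refine prime_pow_dvd_discr_of_pow_eq (a := q ^ (finrank ℚ K - 1)) (α := q * γ) hp
      (fun h => hpq ((Nat.prime_dvd_prime_iff_eq hp hq).mp (hp.dvd_of_dvd_pow h))) ?_
    rw [mul_pow, h]
    conv_lhs => rw [hd, pow_succ]
    push_cast
    field_simp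
  have h2 : q ^ (finrank ℚ K - 1) ∣ (discr K).natAbs := by
    refine prime_pow_dvd_discr_of_pow_eq (a := p ^ (finrank ℚ K - 1)) (α := p * γ⁻¹) hq
      (fun h => hpq ((Nat.prime_dvd_prime_iff_eq hq hp).mp (hq.dvd_of_dvd_pow h)).symm) ?_
    rw [mul_pow, inv_pow, h]
    conv_lhs => rw [hd, pow_succ]
    push_cast
    field_simp
  rw [mul_pow]
  refine Nat.le_of_dvd (Int.natAbs_pos.mpr (discr_ne_zero K)) (Nat.Coprime.mul_dvd_of_dvd_of_dvd
    (Nat.Coprime.pow _ _ ((Nat.coprime_primes hp hq).mpr hpq)) h1 h2)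

end

theorem irreducible_X_pow_sub_C_prime_mul {d p a : ℕ} (hd : 0 < d) (hp : p.Prime) (hpa : ¬ p ∣ a) :
    Irreducible (Polynomial.X ^ d - Polynomial.C ((p * a : ℕ) : ℚ)) := by
  let f : Polynomial ℤ := Polynomial.X ^ d - Polynomial.C ((p * a : ℕ) : ℤ)
  have hfm : f.Monic := Polynomial.monic_X_pow_sub_C _ hd.ne'
  have hdeg : f.natDegree = d := Polynomial.natDegree_X_pow_sub_C
  have hpZ : (Ideal.span {(p : ℤ)}).IsPrime :=
    (Ideal.span_singleton_prime (by exact_mod_cast hp.ne_zero)).mpr (Nat.prime_iff_prime_int.mp hp)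
  have heis : f.IsEisensteinAt (Ideal.span {(p : ℤ)}) := by
    refine ⟨?_, fun {n} hn => ?_, ?_⟩
    · rw [hfm.leadingCoeff]
      exact fun h => hpZ.ne_top ((Ideal.eq_top_iff_one _).mpr h)
    · rw [hdeg] at hn
      rw [Polynomial.coeff_sub, Polynomial.coeff_X_pow, if_neg hn.ne, Polynomial.coeff_C,
        Ideal.mem_span_singleton]
      split_ifs
      · simp
      · simp
    · rw [Ideal.span_singleton_pow, Ideal.mem_span_singleton, Polynomial.coeff_sub,
        Polynomial.coeff_X_pow, if_neg (by lia), Polynomial.coeff_C_zero, zero_sub, dvd_neg]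
      intro h
      have h' : p ^ 2 ∣ p * a := by exact_mod_cast h
      rw [pow_two] at h'
      exact hpa (Nat.dvd_of_mul_dvd_mul_left hp.pos h')
  have hirr : Irreducible f := heis.irreducible hpZ hfm.isPrimitive (by lia)
  have hirrQ : Irreducible (f.map (algebraMap ℤ ℚ)) :=
    (hfm.irreducible_iff_irreducible_map_fraction_map).mp hirr
  simpa [f] using hirrQ

theorem minpoly_eq_X_pow_sub_C_prime_mul {L : Type*} [Field L] [Algebra ℚ L] {d p a : ℕ}
    (hd : 0 < d) (hp : p.Prime) (hpa : ¬ p ∣ a) {α : L} (h : α ^ d = (p : L) * a) :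
    minpoly ℚ α = Polynomial.X ^ d - Polynomial.C ((p * a : ℕ) : ℚ) := by
  refine (minpoly.eq_of_irreducible_of_monic (irreducible_X_pow_sub_C_prime_mul hd hp hpa) ?_
    (Polynomial.monic_X_pow_sub_C _ hd.ne')).symm
  simp [h]

theorem adjoin_eq_top_of_pow_eq_div {K : Type*} [Field K] [NumberField K] {γ : K} {p q : ℕ}
    (hp : p.Prime) (hq : q.Prime) (hpq : p ≠ q) (h : γ ^ finrank ℚ K = (p : K) / q) :
    ℚ⟮γ⟯ = ⊤ := by
  have hd : 0 < finrank ℚ K := finrank_pos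
  have hq0 : (q : K) ≠ 0 := by exact_mod_cast hq.ne_zero
  have hcop : ¬ p ∣ q ^ (finrank ℚ K - 1) := fun h =>
    hpq ((Nat.prime_dvd_prime_iff_eq hp hq).mp (hp.dvd_of_dvd_pow h))
  have hα : ((q : K) * γ) ^ finrank ℚ K = (p : K) * ((q ^ (finrank ℚ K - 1) : ℕ) : K) := by
    have h1 : (q : K) ^ finrank ℚ K = q ^ (finrank ℚ K - 1) * q := by
      rw [← pow_succ, Nat.sub_add_cancel hd]
    rw [mul_pow, h, h1]
    push_cast
    field_simp
  have hdeg := congrArg Polynomial.natDegree (minpoly_eq_X_pow_sub_C_prime_mul hd hp hcop hα)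
  rw [Polynomial.natDegree_X_pow_sub_C] at hdeg
  refine adjoin_eq_top_of_mem
    ((Field.primitive_element_iff_minpoly_natDegree_eq ℚ ((q : K) * γ)).mpr hdeg) ?_
  exact mul_mem (natCast_mem _ q) (IntermediateField.mem_adjoin_simple_self ℚ γ)

theorem DegreeField.finrank_eq {d : ℕ} (K : DegreeField d) : finrank ℚ K.1 = d := by
  convert K.2.2

theorem exists_degreeField_pow_eq_div {d : ℕ} (hd : 0 < d) {p q : ℕ} (hp : p.Prime)
    (hq : q.Prime) (hpq : p ≠ q) : ∃ K : DegreeField d, ∃ γ : K.1, γ ^ d = (p : K.1) / q := by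
  have hcop : ¬ p ∣ q ^ (d - 1) := fun h =>
    hpq ((Nat.prime_dvd_prime_iff_eq hp hq).mp (hp.dvd_of_dvd_pow h))
  -- `α` plays the role of `qγ`: it is a root of an Eisenstein polynomial at `p`.
  obtain ⟨α, hα⟩ := IsAlgClosed.exists_pow_nat_eq
    ((p : AlgebraicClosure ℚ) * ((q ^ (d - 1) : ℕ) : AlgebraicClosure ℚ)) (n := d) hd
  have hmin := minpoly_eq_X_pow_sub_C_prime_mul hd hp hcop hα
  have hαint : IsIntegral ℚ α := by
    by_contra h
    have := (irreducible_X_pow_sub_C_prime_mul hd hp hcop).ne_zero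
    exact this (hmin ▸ minpoly.eq_zero h)
  have hfd : FiniteDimensional ℚ ℚ⟮α⟯ := IntermediateField.adjoin.finiteDimensional hαint
  have hrank : finrank ℚ ℚ⟮α⟯ = d := by
    rw [IntermediateField.adjoin.finrank hαint, hmin, Polynomial.natDegree_X_pow_sub_C]
  refine ⟨⟨ℚ⟮α⟯, hfd, hrank⟩, IntermediateField.AdjoinSimple.gen ℚ α / ((q : ℕ) : ℚ⟮α⟯), ?_⟩
  apply Subtype.ext
  have hq0 : (q : AlgebraicClosure ℚ) ≠ 0 := by exact_mod_cast hq.ne_zero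
  have h1 : (q : AlgebraicClosure ℚ) ^ d = q ^ (d - 1) * q := by
    rw [← pow_succ, Nat.sub_add_cancel hd]
  change (α / q) ^ d = p / q
  rw [div_pow, hα, h1]
  push_cast
  field_simp

/-! ### Two-sided bounds for `M` -/

section

variable {K : Type*} [Field K] [NumberField K]

theorem ne_ratCast_of_adjoin_eq_top {γ : K} (hγ : ℚ⟮γ⟯ = ⊤) (hd : 1 < finrank ℚ K)
    (r : ℚ) : γ ≠ (r : K) := by
  rintro rfl
  have h1 : ℚ⟮(r : K)⟯ = ⊥ :=
    IntermediateField.adjoin_simple_eq_bot_iff.mpr ((⊥ : IntermediateField ℚ K).algebraMap_mem r)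
  rw [h1] at hγ
  rw [← IntermediateField.finrank_top', ← hγ, IntermediateField.finrank_bot] at hd
  exact lt_irrefl _ hd

theorem sq_le_numSmallGenerators {γ : K} (hγ : ℚ⟮γ⟯ = ⊤) (hd : 1 < finrank ℚ K) {T : ℕ} {X : ℝ}
    (hX : (2 * (T : ℝ)) ^ finrank ℚ K * Height.mulHeight₁ γ < X) :
    T ^ 2 ≤ numSmallGenerators K X := by
  let s := Finset.Icc 1 T ×ˢ Finset.Icc 1 T
  have hs : s.card = T ^ 2 := by simp [s, sq]
  have hinj : Set.InjOn (fun x : ℕ × ℕ => (x.1 : K) * γ + x.2) s := by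
    rintro ⟨m, n⟩ - ⟨m', n'⟩ - h
    simp only at h
    have hm : m = m' := by
      by_contra hne
      have hne' : (m : K) - m' ≠ 0 := sub_ne_zero.mpr (by exact_mod_cast hne)
      refine ne_ratCast_of_adjoin_eq_top hγ hd (((n' : ℚ) - n) / (m - m')) ?_
      push_cast
      rw [eq_div_iff hne']
      linear_combination h
    subst hm
    simpa using h
  rw [← hs, ← Set.ncard_coe_finset, ← hinj.ncard_image]
  refine Set.ncard_le_ncard ?_ (smallGenerators_finite K X)
  rintro _ ⟨⟨m, n⟩, hmn, rfl⟩
  simp only [s, Finset.coe_product, Set.mem_prod, Finset.coe_Icc, Set.mem_Icc] at hmn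
  obtain ⟨⟨hm1, hmT⟩, hn1, hnT⟩ := hmn
  refine ⟨adjoin_eq_top_of_mem hγ ?_,
    (mulHeight₁_natCast_mul_add_natCast_le γ (hm1.trans hmT) hmT hnT).trans_lt hX⟩
  have hm0 : (m : K) ≠ 0 := by exact_mod_cast (Nat.one_le_iff_ne_zero.mp hm1)
  have h1 := div_mem (sub_mem (IntermediateField.mem_adjoin_simple_self ℚ ((m : K) * γ + n))
    (natCast_mem _ n)) (natCast_mem ℚ⟮(m : K) * γ + n⟯ m)
  rwa [add_sub_cancel_right, mul_div_cancel_left₀ _ hm0] at h1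

theorem le_ellenbergM {γ : K} (hγ : ℚ⟮γ⟯ = ⊤) (hd : 1 < finrank ℚ K) {ℓ : ℕ}
    (hℓ : finrank ℚ K ≤ 2 * ℓ) :
    1 / 8 * Height.mulHeight₁ γ ^ (-(1 / (ℓ : ℝ))) ≤ ellenbergM K ℓ := by
  have hℓ0 : (0 : ℝ) < ℓ := by
    have : 0 < ℓ := by lia
    exact_mod_cast this
  have hne : Nonempty {X : ℝ // 0 < X} := ⟨⟨1, one_pos⟩⟩
  refine le_ciInf ?_
  rintro ⟨X, hX⟩
  simp only
  set H := Height.mulHeight₁ γ with hH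
  have hHpos : 0 < H := Height.mulHeight₁_pos γ
  have hH1 : 1 ≤ H := Height.one_le_mulHeight₁ γ
  have hex : ∃ N : ℕ, X ≤ (2 * (N : ℝ)) ^ finrank ℚ K * H := by
    obtain ⟨N, hN⟩ := exists_nat_ge (max X 1)
    refine ⟨N, ?_⟩
    have h1 : (1 : ℝ) ≤ N := (le_max_right _ _).trans hN
    calc X ≤ N := (le_max_left _ _).trans hN
      _ ≤ 2 * (N : ℝ) := by linarith
      _ ≤ (2 * (N : ℝ)) ^ finrank ℚ K := le_self_pow₀ (by linarith) (by lia)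
      _ ≤ _ := le_mul_of_one_le_right (by positivity) hH1
  classical
  -- `T` is the last integer with `(2T)^d H < X`; `T = 0` is allowed and covers small `X`.
  obtain ⟨T, hT⟩ : ∃ T, Nat.find hex = T + 1 := by
    refine Nat.exists_eq_succ_of_ne_zero fun h0 => ?_
    have h1 := Nat.find_spec hex
    rw [h0] at h1
    simp [show finrank ℚ K ≠ 0 by lia] at h1
    linarith
  -- Here `d ≤ 2ℓ` enters: the `-1/ℓ` power of this bound costs only `(2(T+1))⁻²`, which the `T²`
  -- generators offset.
  have hup : X ≤ (2 * ((T : ℝ) + 1)) ^ (2 * ℓ) * H := by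
    have h1 := Nat.find_spec hex
    rw [hT] at h1
    push_cast at h1
    refine h1.trans ?_
    gcongr
    have : (0 : ℝ) ≤ T := Nat.cast_nonneg T
    linarith
  have hlow : (2 * (T : ℝ)) ^ finrank ℚ K * H < X :=
    not_le.mp (Nat.find_min hex (by lia))
  have hcount : (T : ℝ) ^ 2 ≤ numSmallGenerators K X := by
    exact_mod_cast sq_le_numSmallGenerators hγ hd hlow
  have hXpow : ((2 * ((T : ℝ) + 1)) ^ 2)⁻¹ * H ^ (-(1 / (ℓ : ℝ))) ≤ X ^ (-(1 / (ℓ : ℝ))) := by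
    have h1 := Real.rpow_le_rpow_of_nonpos hX hup
      (show -(1 / (ℓ : ℝ)) ≤ 0 from neg_nonpos.mpr (by positivity))
    rw [Real.mul_rpow (by positivity) hHpos.le, ← Real.rpow_natCast, ← Real.rpow_mul (by positivity)]
      at h1
    convert h1 using 2
    rw [← Real.rpow_natCast, ← Real.rpow_neg (by positivity)]
    congr 1
    push_cast
    field_simp
  calc 1 / 8 * H ^ (-(1 / (ℓ : ℝ)))
      ≤ (((2 * ((T : ℝ) + 1)) ^ 2)⁻¹ * (1 + (T : ℝ) ^ 2)) * H ^ (-(1 / (ℓ : ℝ))) := by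
        gcongr
        rw [inv_mul_eq_div, le_div_iff₀ (by positivity)]
        -- The constant `1/8` comes from `(T+1)² ≤ 2(1+T²)`.
        nlinarith [sq_nonneg ((T : ℝ) - 1)]
    _ = ((2 * ((T : ℝ) + 1)) ^ 2)⁻¹ * H ^ (-(1 / (ℓ : ℝ))) * (1 + (T : ℝ) ^ 2) := by ring
    _ ≤ _ := by gcongr

theorem ellenbergM_le_of_numSmallGenerators_eq_zero {X : ℝ} (hX : 0 < X)
    (h : numSmallGenerators K X = 0) (ℓ : ℕ) : ellenbergM K ℓ ≤ X ^ (-(1 / (ℓ : ℝ))) := by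
  have hbdd : BddBelow (Set.range fun X : {X : ℝ // 0 < X} =>
      (X : ℝ) ^ (-(1 / (ℓ : ℝ))) * (1 + (numSmallGenerators K X : ℝ))) :=
    ⟨0, by rintro _ ⟨⟨Y, hY⟩, rfl⟩; positivity⟩
  refine (ciInf_le hbdd ⟨X, hX⟩).trans_eq ?_
  simp [h]

theorem absDiscr_pos : (0 : ℝ) < absDiscr K := by
  exact_mod_cast Int.natAbs_pos.mpr (discr_ne_zero K)

theorem ellenbergM_le_exp (hd : 1 < finrank ℚ K) (ℓ : ℕ) :
    ellenbergM K ℓ ≤ Real.exp (-(1 / (2 * (ℓ : ℝ) * ((finrank ℚ K : ℝ) - 1)) *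
      (Real.log (absDiscr K) - 2 * Real.log (finrank ℚ K).factorial))) := by
  set d := finrank ℚ K with hdef
  have hD : (0 : ℝ) < absDiscr K := absDiscr_pos
  have hd1 : (0 : ℝ) < (d : ℝ) - 1 := sub_pos.mpr (by exact_mod_cast hd)
  have hcast : ((d - 1 : ℕ) : ℝ) = (d : ℝ) - 1 := by rw [Nat.cast_sub hd.le, Nat.cast_one]
  have hf : (0 : ℝ) < d.factorial := by exact_mod_cast d.factorial_pos
  set c := Real.log (absDiscr K) - 2 * Real.log d.factorial with hc
  -- This `X` is `(D_K/(d!)²)^(1/(2(d-1)))`, the threshold below which no generator exists.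
  have hzero : numSmallGenerators K (Real.exp (c / (2 * ((d : ℝ) - 1)))) = 0 := by
    rw [numSmallGenerators, Set.ncard_eq_zero (smallGenerators_finite K _),
      Set.eq_empty_iff_forall_notMem]
    rintro γ ⟨hγ, hlt⟩
    have h1 := discr_le_mulHeight₁_pow hγ
    have hHpos := Height.mulHeight₁_pos γ
    have h2 := Real.log_le_log hD h1
    rw [Real.log_mul (by positivity) (by positivity), Real.log_pow, Real.log_pow] at h2
    push_cast at h2
    rw [← hdef, hcast] at h2
    have h3 := (Real.log_lt_iff_lt_exp hHpos).mpr hlt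
    rw [lt_div_iff₀ (by positivity)] at h3
    linarith
  refine (ellenbergM_le_of_numSmallGenerators_eq_zero (Real.exp_pos _) hzero ℓ).trans_eq ?_
  rw [← Real.exp_mul]
  congr 1
  -- For `ℓ = 0` both exponents are zero, as `1/0 = 0`.
  rcases Nat.eq_zero_or_pos ℓ with rfl | hℓ
  · simp
  · field_simp

theorem exp_le_ellenbergM (hd : 1 < finrank ℚ K) {ℓ : ℕ} (hℓ : finrank ℚ K ≤ 2 * ℓ) {γ : K}
    {p q : ℕ} (hp : p.Prime) (hq : q.Prime) (hpq : p < q) (hqp : q ≤ 2 * p)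
    (h : γ ^ finrank ℚ K = (p : K) / q) :
    Real.exp (-(Real.log 8 + 1 / (2 * (ℓ : ℝ) * ((finrank ℚ K : ℝ) - 1)) *
      (Real.log (absDiscr K) + ((finrank ℚ K : ℝ) - 1) * Real.log 2))) ≤ ellenbergM K ℓ := by
  refine le_trans ?_ (le_ellenbergM (adjoin_eq_top_of_pow_eq_div hp hq hpq.ne h) hd hℓ)
  have hD : (0 : ℝ) < absDiscr K := absDiscr_pos
  have hH := mulHeight₁_le_of_pow_eq_div hq.ne_zero hpq.le h
  have hdisc := mul_pow_le_absDiscr hp hq hpq.ne h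
  set d := finrank ℚ K with hdef
  have hd1 : (0 : ℝ) < (d : ℝ) - 1 := sub_pos.mpr (by exact_mod_cast hd)
  have hcast : ((d - 1 : ℕ) : ℝ) = (d : ℝ) - 1 := by rw [Nat.cast_sub hd.le, Nat.cast_one]
  have hℓ0 : (0 : ℝ) < ℓ := by
    have : 0 < ℓ := by lia
    exact_mod_cast this
  have hHpos := Height.mulHeight₁_pos γ
  set H := Height.mulHeight₁ γ
  -- From `q ≤ 2p` one gets `q² ≤ 2pq`, so the height is controlled by the discriminant.
  have hpow : H ^ (2 * (d - 1)) ≤ 2 ^ (d - 1) * (absDiscr K : ℝ) := by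
    calc H ^ (2 * (d - 1)) ≤ (q : ℝ) ^ (2 * (d - 1)) := by gcongr
      _ = ((q : ℝ) ^ 2) ^ (d - 1) := pow_mul _ _ _
      _ ≤ (2 * ((p : ℝ) * q)) ^ (d - 1) := by
          have : (q : ℝ) ≤ 2 * p := by exact_mod_cast hqp
          gcongr
          nlinarith [(Nat.cast_nonneg q : (0 : ℝ) ≤ q)]
      _ = 2 ^ (d - 1) * ((p : ℝ) * q) ^ (d - 1) := mul_pow _ _ _
      _ ≤ _ := by
          gcongr
          exact_mod_cast hdisc
  have hlog := Real.log_le_log (by positivity) hpow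
  rw [Real.log_mul (by positivity) hD.ne', Real.log_pow, Real.log_pow] at hlog
  push_cast at hlog
  rw [hcast] at hlog
  rw [← Real.le_log_iff_exp_le (by positivity), Real.log_mul (by norm_num) (by positivity),
    Real.log_rpow hHpos, one_div 8, Real.log_inv]
  have h1 : 1 / (ℓ : ℝ) * Real.log H ≤ 1 / (2 * (ℓ : ℝ) * ((d : ℝ) - 1)) *
      (Real.log (absDiscr K) + ((d : ℝ) - 1) * Real.log 2) := by
    rw [div_mul_eq_mul_div, div_mul_eq_mul_div, div_le_div_iff₀ hℓ0 (by positivity)]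
    nlinarith
  linarith

end

/-! ### Passage to the lower limit -/

theorem ellenbergExponent_ge {ℓ d : ℕ} (hd : 1 < d) :
    ((1 / (2 * (ℓ : ℝ) * ((d : ℝ) - 1)) : ℝ) : EReal) ≤ ellenbergExponent ℓ d := by
  rw [← EReal.ge_of_forall_gt_iff_ge]
  intro c hc
  rw [EReal.coe_lt_coe_iff] at hc
  set s := 1 / (2 * (ℓ : ℝ) * ((d : ℝ) - 1)) with hs
  set k := 2 * Real.log d.factorial
  have htend : Tendsto (fun K : DegreeField d => Real.log (absDiscr K.1))
      (comap (fun K : DegreeField d => absDiscr K.1) atTop) atTop :=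
    Real.tendsto_log_atTop.comp (tendsto_natCast_atTop_atTop.comp tendsto_comap)
  refine le_liminf_of_le (by isBoundedDefault) ?_
  -- Past this threshold `s (log D_K - k) ≥ c log D_K`, absorbing the constant.
  filter_upwards [htend.eventually_gt_atTop 0, htend.eventually_ge_atTop (s * k / (s - c))]
    with K h0 h1
  have hM := ellenbergM_le_exp (K := K.1) (by rwa [K.finrank_eq]) ℓ
  rw [K.finrank_eq] at hM
  rw [div_le_iff₀ (sub_pos.mpr hc)] at h1
  have h2 : ENNReal.log (ENNReal.ofReal (ellenbergM K.1 ℓ)) ≤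
      ((-(s * (Real.log (absDiscr K.1) - k)) : ℝ) : EReal) := by
    refine (ENNReal.log_monotone (ENNReal.ofReal_le_ofReal hM)).trans_eq ?_
    rw [ENNReal.log_ofReal_of_pos (Real.exp_pos _), Real.log_exp]
  rw [EReal.le_div_iff_mul_le (by exact_mod_cast h0) (EReal.coe_ne_top _), ← EReal.coe_mul]
  refine le_trans ?_ (EReal.neg_le_neg_iff.mpr h2)
  rw [← EReal.coe_neg, EReal.coe_le_coe_iff]
  linarith

theorem ellenbergExponent_le {ℓ d : ℕ} (hd : 1 < d) (hℓ : d ≤ 2 * ℓ) :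
    ellenbergExponent ℓ d ≤ ((1 / (2 * (ℓ : ℝ) * ((d : ℝ) - 1)) : ℝ) : EReal) := by
  rw [← EReal.le_of_forall_lt_iff_le]
  intro c hc
  rw [EReal.coe_lt_coe_iff] at hc
  set s := 1 / (2 * (ℓ : ℝ) * ((d : ℝ) - 1)) with hs
  set k := Real.log 8 + s * (((d : ℝ) - 1) * Real.log 2)
  refine liminf_le_of_frequently_le ?_ (by isBoundedDefault)
  have htend : Tendsto (fun n : ℕ => Real.log (n : ℝ)) atTop atTop :=
    Real.tendsto_log_atTop.comp tendsto_natCast_atTop_atTop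
  obtain ⟨N₀, hN₀⟩ := eventually_atTop.mp
    ((htend.eventually_gt_atTop 0).and (htend.eventually_ge_atTop (k / (c - s))))
  rw [(atTop_basis.comap _).frequently_iff]
  intro N _
  obtain ⟨p, hpN, hp⟩ := Nat.exists_infinite_primes (max N N₀)
  -- Bertrand's postulate supplies `q`; since `D_K ≥ pq ≥ p`, the discriminants are unbounded.
  obtain ⟨q, hq, hpq, hqp⟩ := Nat.exists_prime_lt_and_le_two_mul p hp.ne_zero
  obtain ⟨K, γ, hγ⟩ := exists_degreeField_pow_eq_div (d := d) (by lia) hp hq hpq.ne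
  have hγ' : γ ^ finrank ℚ K.1 = (p : K.1) / q := by rwa [K.finrank_eq]
  have hK : max N N₀ ≤ absDiscr K.1 := by
    have h1 := mul_pow_le_absDiscr hp hq hpq.ne hγ'
    rw [K.finrank_eq] at h1
    calc max N N₀ ≤ p := hpN
      _ ≤ p * q := Nat.le_mul_of_pos_right p hq.pos
      _ ≤ (p * q) ^ (d - 1) := Nat.le_self_pow (by lia) _
      _ ≤ _ := h1
  refine ⟨K, (le_max_left _ _).trans hK, ?_⟩
  obtain ⟨h0, h1⟩ := hN₀ _ ((le_max_right _ _).trans hK)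
  have hM := exp_le_ellenbergM (by rwa [K.finrank_eq]) (by rwa [K.finrank_eq]) hp hq hpq hqp hγ'
  rw [K.finrank_eq] at hM
  rw [div_le_iff₀ (sub_pos.mpr hc)] at h1
  have h2 := ENNReal.log_monotone (ENNReal.ofReal_le_ofReal hM)
  rw [ENNReal.log_ofReal_of_pos (Real.exp_pos _), Real.log_exp] at h2
  rw [EReal.div_le_iff_le_mul (by exact_mod_cast h0) (EReal.coe_ne_top _), ← EReal.coe_mul]
  refine (EReal.neg_le_neg_iff.mpr h2).trans ?_
  rw [← EReal.coe_neg, EReal.coe_le_coe_iff]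
  linarith

theorem proposition1 (ℓ d : ℕ) (hd : 1 < d) (hℓ : (d : ℝ) / 2 ≤ (ℓ : ℝ)) :
    ellenbergExponent ℓ d = ((1 / (2 * (ℓ : ℝ) * ((d : ℝ) - 1)) : ℝ) : EReal) := by
  have hℓ' : d ≤ 2 * ℓ := by
    have : (d : ℝ) ≤ 2 * ℓ := by linarith
    exact_mod_cast this
  exact le_antisymm (ellenbergExponent_le hd hℓ') (ellenbergExponent_ge hd)
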